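/- Let $k>0$, $\beta>0$, $\beta_r\ge 0$ and $0<T_\infty<T_d$ be real constants, let $a_0,\ell>0$ and let $V_0>\ell a_0^2$. Let $$\mathcal V_{a_0,\ell,V_0}=\Big\{a\in W^{1,\infty}(0,\ell)\ :\ a\ge a_0 \text{ a.e. in } (0,\ell),\ \int_0^\ell a(x)^2\,dx\le V_0\Big\},$$ and for $a\in\mathcal V_{a_0,\ell,V_0}$ let $F(a)=-k\pi\, a(0)^2\, T'(0)$, where $T\in H^1(0,\ell)$ is the unique solution of $$(a^2T')'=\beta\, a\sqrt{1+a'^2}\,(T-T_\infty)\ \text{ in }(0,\ell),\qquad T(0)=T_d,\qquad T'(\ell)=-\beta_r\,(T(\ell)-T_\infty).$$ Then the problem of maximizing $F$ over $\mathcal V_{a_0,\ell,V_0}$ has no solution, and $$\sup_{a\in\mathcal V_{a_0,\ell,V_0}}F(a)=+\infty.$$ -/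

import Mathlib

open MeasureTheory Set
open scoped ContDiff ENNReal

/-- `g` is the weak (distributional) derivative of `f` on the interval `(0, ℓ)`; both functions are
integrable there. -/
def HasWeakDeriv (ℓ : ℝ) (f g : ℝ → ℝ) : Prop :=
  IntegrableOn f (Ioo 0 ℓ) ∧ IntegrableOn g (Ioo 0 ℓ) ∧
    ∀ φ : ℝ → ℝ, ContDiff ℝ ∞ φ → HasCompactSupport φ → tsupport φ ⊆ Ioo 0 ℓ →
      ∫ x in Ioo 0 ℓ, f x * deriv φ x = - ∫ x in Ioo 0 ℓ, g x * φ x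

/-- `f` belongs to the Sobolev space `W^{1,p}(0, ℓ)`. In dimension one every class of `W^{1,p}(0, ℓ)`
has exactly one representative that is continuous on `[0, ℓ]`; elements are given by this
representative, so that the endpoint values `f 0` and `f ℓ` make sense. Values of `f` outside
`[0, ℓ]` are irrelevant. -/
structure MemSobolev (p : ℝ≥0∞) (ℓ : ℝ) (f : ℝ → ℝ) : Prop where
  continuousOn : ContinuousOn f (Icc 0 ℓ)
  memLp : MemLp f p (volume.restrict (Ioo 0 ℓ))
  exists_weakDeriv : ∃ g : ℝ → ℝ, MemLp g p (volume.restrict (Ioo 0 ℓ)) ∧ HasWeakDeriv ℓ f g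

open Classical in
/-- The weak derivative on `(0, ℓ)` (unique almost everywhere), and `0` if there is none. -/
noncomputable def weakDeriv (ℓ : ℝ) (f : ℝ → ℝ) : ℝ → ℝ :=
  if h : ∃ g : ℝ → ℝ, HasWeakDeriv ℓ f g then h.choose else 0

/-- `T ∈ H¹(0, ℓ)` solves the fin equation with radius `a`:
`(a² T')' = β a √(1 + a'²) (T - T∞)` on `(0, ℓ)` in the sense of distributions, `T(0) = T_d` and
`T'(ℓ) = - β_r (T(ℓ) - T∞)`. For an admissible radius `a`, such a `T` is of class `C¹` on `[0, ℓ]`,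
so that the endpoint values of `T'` are one-sided derivatives. -/
structure IsTemperature (ℓ β βr Td Tinf : ℝ) (a T : ℝ → ℝ) : Prop where
  memSobolev : MemSobolev 2 ℓ T
  equation : HasWeakDeriv ℓ (fun x => a x ^ 2 * weakDeriv ℓ T x)
    (fun x => β * (a x * √(1 + weakDeriv ℓ a x ^ 2)) * (T x - Tinf))
  inlet : T 0 = Td
  tip : HasDerivWithinAt T (-βr * (T ℓ - Tinf)) (Icc 0 ℓ) ℓ

open Classical in
/-- The inlet heat flux `F(a) = - k π a(0)² T'(0)`, where `T` is the solution of the fin equation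
with radius `a` (unique on `[0, ℓ]`). -/
noncomputable def heatFlux (ℓ k β βr Td Tinf : ℝ) (a : ℝ → ℝ) : ℝ :=
  if h : ∃ T : ℝ → ℝ, IsTemperature ℓ β βr Td Tinf a T then
    -k * Real.pi * a 0 ^ 2 * derivWithin h.choose (Icc 0 ℓ) 0
  else 0

/-- `vol(a) = ∫₀^ℓ a(x)² dx`. -/
noncomputable def finVol (ℓ : ℝ) (a : ℝ → ℝ) : ℝ := ∫ x in Ioo 0 ℓ, a x ^ 2

/-- The admissible radii: `a ∈ W^{1,∞}(0, ℓ)`, `a ≥ a₀` almost everywhere and `vol(a) ≤ V₀`. -/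
def volClass (a₀ ℓ V₀ : ℝ) : Set (ℝ → ℝ) :=
  {a | MemSobolev ∞ ℓ a ∧ (∀ᵐ x ∂(volume.restrict (Ioo 0 ℓ)), a₀ ≤ a x) ∧ finVol ℓ a ≤ V₀}

/-!
Write `T' = -q (T - T∞) / a²`. The conductance `q` solves the Riccati equation
`q' = q² / a² - β a √(1 + a'²)` backwards from `q(ℓ) = βr a(ℓ)²`, and `F(a) = k π (T_d - T∞) q(0)`.
If `a` decreases fast enough, namely `β (a - a(ℓ)) ≤ -2 a'`, then `β / 4 (a² - a(ℓ)²)` is a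
subsolution, so the flux is at least a multiple of the inlet area in excess of the tip area. The
radii `a₀ + B (1 - x / ℓ)ⁿ` satisfy this condition for large `n`, and their volume tends to `ℓ a₀²`
while their inlet area `π (a₀ + B)²` is arbitrarily large.
-/

open Filter
open scoped NNReal Topology

theorem integrable_mul_of_hasCompactSupport {X : Type*} [TopologicalSpace X] [MeasurableSpace X]
    [OpensMeasurableSpace X] {μ : Measure X} {f φ : X → ℝ} (hf : Integrable f μ)
    (hφ : Continuous φ) (hc : HasCompactSupport φ) : Integrable (fun x => f x * φ x) μ := by
  obtain ⟨C, hC⟩ := hφ.bounded_above_of_compact_support hc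
  exact hf.mul_bdd hφ.aestronglyMeasurable (.of_forall hC)

theorem setIntegral_eq_integral_of_tsupport_subset {X : Type*} [TopologicalSpace X]
    [MeasurableSpace X] {μ : Measure X} {s : Set X} {φ : X → ℝ} (hφ : tsupport φ ⊆ s) :
    ∫ x in s, φ x ∂μ = ∫ x, φ x ∂μ :=
  setIntegral_eq_integral_of_forall_compl_eq_zero fun _ hx =>
    image_eq_zero_of_notMem_tsupport fun h => hx (hφ h)

theorem ae_restrict_eq_zero_of_integral_mul_contDiff_eq_zero {E : Type*} [NormedAddCommGroup E]
    [NormedSpace ℝ E] [FiniteDimensional ℝ E] [MeasurableSpace E] [BorelSpace E] {μ : Measure E}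
    {U : Set E} (hU : IsOpen U) {f : E → ℝ} (hf : IntegrableOn f U μ)
    (h : ∀ φ : E → ℝ, ContDiff ℝ ∞ φ → HasCompactSupport φ → tsupport φ ⊆ U →
      ∫ x in U, f x * φ x ∂μ = 0) :
    f =ᵐ[μ.restrict U] 0 := by
  rw [Filter.EventuallyEq, ae_restrict_iff' hU.measurableSet]
  refine hU.ae_eq_zero_of_integral_contDiff_smul_eq_zero hf.locallyIntegrableOn
    fun φ hφ hc hs => ?_
  rw [← setIntegral_eq_integral_of_tsupport_subset (tsupport_smul_subset_left φ f |>.trans hs),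
    ← h φ hφ hc hs]
  simp only [smul_eq_mul, mul_comm]

theorem hasDerivWithinAt_integral_Icc {E : Type*} [NormedAddCommGroup E] [NormedSpace ℝ E]
    [CompleteSpace E] {a b x : ℝ} {g : ℝ → E} (hg : ContinuousOn g (Icc a b))
    (hx : x ∈ Icc a b) :
    HasDerivWithinAt (fun u => ∫ t in a..u, g t) (g x) (Icc a b) x := by
  have : Fact (x ∈ Icc a b) := ⟨hx⟩
  exact intervalIntegral.integral_hasDerivWithinAt_right
    ((hg.mono (Icc_subset_Icc_right hx.2)).intervalIntegrable_of_Icc hx.1)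
    (hg.stronglyMeasurableAtFilter_nhdsWithin measurableSet_Icc x) (hg x hx)

theorem exists_contDiff_tsupport_subset_Ioo_integral_eq_one {a b : ℝ} (hab : a < b) :
    ∃ ψ : ℝ → ℝ, ContDiff ℝ ∞ ψ ∧ HasCompactSupport ψ ∧ tsupport ψ ⊆ Ioo a b ∧
      ∫ x, ψ x = 1 := by
  let ψ : ContDiffBump ((a + b) / 2) := ⟨(b - a) / 8, (b - a) / 4, by linarith, by linarith⟩
  refine ⟨ψ.normed volume, ψ.contDiff_normed, ψ.hasCompactSupport_normed, ?_, ψ.integral_normed⟩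
  rw [ψ.tsupport_normed_eq, Real.closedBall_eq_Icc]
  refine Icc_subset_Ioo ?_ ?_ <;> dsimp only [ψ] <;> linarith

theorem exists_Icc_superset_of_isCompact_subset_Ioo {α : Type*}
    [ConditionallyCompleteLinearOrder α] [TopologicalSpace α] [OrderTopology α] {a b : α}
    (hab : a < b) {K : Set α} (hK : IsCompact K) (hs : K ⊆ Ioo a b) :
    ∃ c d, a < c ∧ d < b ∧ K ⊆ Icc c d := by
  rcases K.eq_empty_or_nonempty with rfl | hne
  · exact ⟨b, a, hab, hab, empty_subset _⟩
  · exact ⟨sInf K, sSup K, (hs (hK.sInf_mem hne)).1, (hs (hK.sSup_mem hne)).2,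
      fun x hx => ⟨csInf_le hK.bddBelow hx, le_csSup hK.bddAbove hx⟩⟩

theorem exists_contDiff_primitive_of_integral_eq_zero {a b : ℝ} (hab : a < b) {χ : ℝ → ℝ}
    (hχ : ContDiff ℝ ∞ χ) (hs : tsupport χ ⊆ Ioo a b) (h0 : ∫ x, χ x = 0) :
    ∃ φ : ℝ → ℝ, ContDiff ℝ ∞ φ ∧ HasCompactSupport φ ∧ tsupport φ ⊆ Ioo a b ∧ deriv φ = χ := by
  have hK : IsCompact (tsupport χ) :=
    isCompact_Icc.of_isClosed_subset (isClosed_tsupport χ) (hs.trans Ioo_subset_Icc_self)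
  obtain ⟨c, d, hac, hdb, hcd⟩ := exists_Icc_superset_of_isCompact_subset_Ioo hab hK hs
  let φ : ℝ → ℝ := fun u => ∫ t in a..u, χ t
  have hφ : ∀ x, HasDerivAt φ (χ x) x := fun x =>
    (hχ.continuous.integral_hasStrictDerivAt a x).hasDerivAt
  have hderiv : deriv φ = χ := funext fun x => (hφ x).deriv
  have hzero : ∀ x, x ∉ Icc c d → χ x = 0 := fun x hx =>
    image_eq_zero_of_notMem_tsupport fun h => hx (hcd h)
  have hsupp : tsupport φ ⊆ Icc c d := by
    refine closure_minimal (Function.support_subset_iff'.2 fun x hx => ?_) isClosed_Icc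
    rcases lt_or_ge x c with hxc | hcx
    · refine intervalIntegral.integral_zero_ae (.of_forall fun t ht => hzero t fun h => ?_)
      exact (ht.2.trans_lt (max_lt hac hxc)).not_ge h.1
    · have hdx : d < x := not_le.1 fun h => hx ⟨hcx, h⟩
      rw [← h0]
      exact intervalIntegral.integral_eq_integral_of_support_subset fun t ht =>
        have ht' := hcd (subset_tsupport χ ht)
        ⟨hac.trans_le ht'.1, ht'.2.trans hdx.le⟩
  refine ⟨φ, ?_, isCompact_Icc.of_isClosed_subset (isClosed_tsupport _) hsupp,
    hsupp.trans (Icc_subset_Ioo hac hdb), hderiv⟩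
  rw [contDiff_infty_iff_deriv, hderiv]
  exact ⟨fun x => (hφ x).differentiableAt, hχ⟩

section WeakDeriv

variable {ℓ : ℝ} {f g f₁ f₂ g₁ g₂ : ℝ → ℝ}

theorem HasWeakDeriv.congr_ae (h : HasWeakDeriv ℓ f₁ g₁)
    (hf : f₁ =ᵐ[volume.restrict (Ioo 0 ℓ)] f₂) (hg : g₁ =ᵐ[volume.restrict (Ioo 0 ℓ)] g₂) :
    HasWeakDeriv ℓ f₂ g₂ := by
  refine ⟨h.1.congr hf, h.2.1.congr hg, fun φ hφ hc hs => ?_⟩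
  calc ∫ x in Ioo 0 ℓ, f₂ x * deriv φ x
    _ = ∫ x in Ioo 0 ℓ, f₁ x * deriv φ x := integral_congr_ae (hf.symm.mul .rfl)
    _ = -∫ x in Ioo 0 ℓ, g₁ x * φ x := h.2.2 φ hφ hc hs
    _ = -∫ x in Ioo 0 ℓ, g₂ x * φ x := congrArg Neg.neg (integral_congr_ae (hg.mul .rfl))

theorem HasWeakDeriv.sub (h₁ : HasWeakDeriv ℓ f₁ g₁) (h₂ : HasWeakDeriv ℓ f₂ g₂) :
    HasWeakDeriv ℓ (fun x => f₁ x - f₂ x) (fun x => g₁ x - g₂ x) := by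
  refine ⟨h₁.1.sub h₂.1, h₁.2.1.sub h₂.2.1, fun φ hφ hc hs => ?_⟩
  have hφ' : Continuous (deriv φ) := hφ.continuous_deriv (by simp)
  simp only [sub_mul]
  rw [integral_sub (integrable_mul_of_hasCompactSupport h₁.1 hφ' hc.deriv)
      (integrable_mul_of_hasCompactSupport h₂.1 hφ' hc.deriv),
    integral_sub (integrable_mul_of_hasCompactSupport h₁.2.1 hφ.continuous hc)
      (integrable_mul_of_hasCompactSupport h₂.2.1 hφ.continuous hc),
    h₁.2.2 φ hφ hc hs, h₂.2.2 φ hφ hc hs]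
  ring

theorem HasWeakDeriv.ae_eq (h₁ : HasWeakDeriv ℓ f g₁) (h₂ : HasWeakDeriv ℓ f g₂) :
    g₁ =ᵐ[volume.restrict (Ioo 0 ℓ)] g₂ := by
  have h := h₁.sub h₂
  refine (ae_restrict_eq_zero_of_integral_mul_contDiff_eq_zero isOpen_Ioo h.2.1
    fun φ hφ hc hs => ?_).mono fun x hx => sub_eq_zero.1 hx
  simpa using (h.2.2 φ hφ hc hs).symm

theorem hasWeakDeriv_weakDeriv (h : HasWeakDeriv ℓ f g) : HasWeakDeriv ℓ f (weakDeriv ℓ f) := by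
  have h' : ∃ g, HasWeakDeriv ℓ f g := ⟨g, h⟩
  rw [weakDeriv, dif_pos h']
  exact h'.choose_spec

theorem HasWeakDeriv.weakDeriv_ae_eq (h : HasWeakDeriv ℓ f g) :
    weakDeriv ℓ f =ᵐ[volume.restrict (Ioo 0 ℓ)] g :=
  (hasWeakDeriv_weakDeriv h).ae_eq h

theorem hasWeakDeriv_of_hasDerivWithinAt (hℓ : 0 ≤ ℓ)
    (hf : ∀ x ∈ Icc 0 ℓ, HasDerivWithinAt f (g x) (Icc 0 ℓ) x)
    (hg : ContinuousOn g (Icc 0 ℓ)) : HasWeakDeriv ℓ f g := by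
  have hfc : ContinuousOn f (Icc 0 ℓ) := HasDerivWithinAt.continuousOn hf
  refine ⟨hfc.integrableOn_Icc.mono_set Ioo_subset_Icc_self,
    hg.integrableOn_Icc.mono_set Ioo_subset_Icc_self, fun φ hφ _ hs => ?_⟩
  have hφ0 : φ 0 = 0 := image_eq_zero_of_notMem_tsupport fun h => (hs h).1.false
  have hφℓ : φ ℓ = 0 := image_eq_zero_of_notMem_tsupport fun h => (hs h).2.false
  have hφ' : Continuous (deriv φ) := hφ.continuous_deriv (by simp)
  rw [← integral_Ioc_eq_integral_Ioo, ← integral_Ioc_eq_integral_Ioo,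
    ← intervalIntegral.integral_of_le hℓ, ← intervalIntegral.integral_of_le hℓ,
    intervalIntegral.integral_mul_deriv_eq_deriv_mul_of_hasDerivWithinAt (u' := g) (v := φ)
      (by rwa [uIcc_of_le hℓ])
      (fun x _ => (hφ.differentiable (by simp) x).hasDerivAt.hasDerivWithinAt)
      (hg.intervalIntegrable_of_Icc hℓ) (hφ'.intervalIntegrable _ _), hφ0, hφℓ]
  ring

-- The du Bois-Reymond lemma: testing with the primitive of `χ - (∫ χ) ψ`, where `∫ ψ = 1`, shows
-- that `f - ∫ f ψ` is orthogonal to every test function `χ`.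
theorem HasWeakDeriv.exists_ae_eq_const (hf : HasWeakDeriv ℓ f 0) (hℓ : 0 < ℓ) :
    ∃ c : ℝ, f =ᵐ[volume.restrict (Ioo 0 ℓ)] fun _ => c := by
  obtain ⟨ψ, hψ, hψc, hψs, hψ1⟩ := exists_contDiff_tsupport_subset_Ioo_integral_eq_one hℓ
  let c : ℝ := ∫ x in Ioo 0 ℓ, f x * ψ x
  have hfc : IntegrableOn (fun x => f x - c) (Ioo 0 ℓ) :=
    hf.1.sub (integrableOn_const measure_Ioo_lt_top.ne)
  refine ⟨c, (ae_restrict_eq_zero_of_integral_mul_contDiff_eq_zero isOpen_Ioo hfc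
    fun χ hχ hχc hχs => ?_).mono fun x hx => sub_eq_zero.1 hx⟩
  let m : ℝ := ∫ x, χ x
  obtain ⟨φ, hφ, hφc, hφs, hφ'⟩ := exists_contDiff_primitive_of_integral_eq_zero hℓ
    (χ := fun x => χ x - m * ψ x) (hχ.sub (contDiff_const.mul hψ))
    ((tsupport_sub _ _).trans (union_subset hχs (tsupport_mul_subset_right.trans hψs)))
    (by
      rw [integral_sub (hχ.continuous.integrable_of_hasCompactSupport hχc)
        ((hψ.continuous.integrable_of_hasCompactSupport hψc).const_mul m), integral_const_mul,
        hψ1, mul_one, sub_self])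
  have hfχ := integrable_mul_of_hasCompactSupport hf.1 hχ.continuous hχc
  have hfψ := integrable_mul_of_hasCompactSupport hf.1 hψ.continuous hψc
  have hχi : IntegrableOn χ (Ioo 0 ℓ) :=
    (hχ.continuous.integrable_of_hasCompactSupport hχc).integrableOn
  have horth : (∫ x in Ioo 0 ℓ, f x * χ x) - m * c = 0 := by
    rw [← integral_const_mul, ← integral_sub hfχ (hfψ.const_mul m)]
    simpa [hφ', mul_sub, mul_left_comm] using hf.2.2 φ hφ hφc hφs
  simp only [sub_mul]
  rw [integral_sub hfχ (hχi.const_mul c), integral_const_mul,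
    setIntegral_eq_integral_of_tsupport_subset hχs, mul_comm]
  exact horth

theorem HasWeakDeriv.exists_ae_eq_primitive (h : HasWeakDeriv ℓ f g) (hℓ : 0 < ℓ)
    (hg : ContinuousOn g (Icc 0 ℓ)) :
    ∃ F : ℝ → ℝ, f =ᵐ[volume.restrict (Ioo 0 ℓ)] F ∧
      ∀ x ∈ Icc 0 ℓ, HasDerivWithinAt F (g x) (Icc 0 ℓ) x := by
  have hG : ∀ x ∈ Icc 0 ℓ, HasDerivWithinAt (fun u => ∫ t in (0 : ℝ)..u, g t) (g x) (Icc 0 ℓ) x :=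
    fun x hx => hasDerivWithinAt_integral_Icc hg hx
  have hdiff := (h.sub (hasWeakDeriv_of_hasDerivWithinAt hℓ.le hG hg)).congr_ae .rfl
    (g₂ := 0) (.of_forall fun x => sub_self (g x))
  obtain ⟨c, hc⟩ := hdiff.exists_ae_eq_const hℓ
  exact ⟨fun x => c + ∫ t in (0 : ℝ)..x, g t, hc.mono fun x hx => eq_add_of_sub_eq hx,
    fun x hx => (hG x hx).const_add c⟩

theorem HasWeakDeriv.hasDerivWithinAt (h : HasWeakDeriv ℓ f g) (hℓ : 0 < ℓ)
    (hf : ContinuousOn f (Icc 0 ℓ)) (hg : ContinuousOn g (Icc 0 ℓ)) :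
    ∀ x ∈ Icc 0 ℓ, HasDerivWithinAt f (g x) (Icc 0 ℓ) x := by
  obtain ⟨F, hfF, hF⟩ := h.exists_ae_eq_primitive hℓ hg
  rw [restrict_Ioo_eq_restrict_Icc] at hfF
  have heq : EqOn f F (Icc 0 ℓ) :=
    Measure.eqOn_Icc_of_ae_eq volume hℓ.ne hfF hf (HasDerivWithinAt.continuousOn hF)
  exact fun x hx => (hF x hx).congr_of_mem heq hx

theorem memLp_restrict_Ioo_of_continuousOn {a b : ℝ} (hf : ContinuousOn f (Icc a b)) (p : ℝ≥0∞) :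
    MemLp f p (volume.restrict (Ioo a b)) := by
  obtain ⟨C, hC⟩ := isCompact_Icc.exists_bound_of_continuousOn hf
  refine .of_bound ((hf.mono Ioo_subset_Icc_self).aestronglyMeasurable measurableSet_Ioo) C ?_
  filter_upwards [ae_restrict_mem measurableSet_Ioo] with x hx using hC x (Ioo_subset_Icc_self hx)

theorem memSobolev_of_hasDerivWithinAt (hℓ : 0 ≤ ℓ) (p : ℝ≥0∞)
    (hf : ∀ x ∈ Icc 0 ℓ, HasDerivWithinAt f (g x) (Icc 0 ℓ) x)
    (hg : ContinuousOn g (Icc 0 ℓ)) : MemSobolev p ℓ f where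
  continuousOn := HasDerivWithinAt.continuousOn hf
  memLp := memLp_restrict_Ioo_of_continuousOn (HasDerivWithinAt.continuousOn hf) p
  exists_weakDeriv := ⟨g, memLp_restrict_Ioo_of_continuousOn hg p,
    hasWeakDeriv_of_hasDerivWithinAt hℓ hf hg⟩

end WeakDeriv

section Riccati

variable {a b : ℝ} {m h q p w w' : ℝ → ℝ}

theorem nonpos_of_right_endpoint_nonpos
    (hw : ∀ t ∈ Icc a b, HasDerivWithinAt w (w' t) (Icc a b) t) (hb : w b ≤ 0)
    (hpos : ∀ t ∈ Icc a b, 0 < w t → 0 ≤ w' t) : ∀ t ∈ Icc a b, w t ≤ 0 := by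
  intro t ht
  by_contra! hwt
  have hcont : ContinuousOn w (Icc t b) :=
    (HasDerivWithinAt.continuousOn hw).mono (Icc_subset_Icc_left ht.1)
  obtain ⟨s, ⟨hs, hws⟩, hfirst⟩ : ∃ s, IsLeast (Icc t b ∩ w ⁻¹' Iic 0) s :=
    (isCompact_Icc.of_isClosed_subset
      (hcont.preimage_isClosed_of_isClosed isClosed_Icc isClosed_Iic)
      inter_subset_left).exists_isLeast ⟨b, right_mem_Icc.2 ht.2, hb⟩
  have hsub : Icc t s ⊆ Icc a b := Icc_subset_Icc ht.1 hs.2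
  have hmono : MonotoneOn w (Icc t s) := by
    refine monotoneOn_of_hasDerivWithinAt_nonneg (f' := w') (convex_Icc t s)
      (hcont.mono (Icc_subset_Icc_right hs.2))
      (fun x hx => (hw x (hsub (interior_subset hx))).mono (interior_subset.trans hsub))
      fun x hx => ?_
    rw [interior_Icc] at hx
    have hxI : x ∈ Icc t s := Ioo_subset_Icc_self hx
    refine hpos x (hsub hxI) (not_le.1 fun hwx => hx.2.not_ge ?_)
    exact hfirst ⟨⟨hxI.1, hxI.2.trans hs.2⟩, hwx⟩
  exact (hwt.trans_le (hmono (left_mem_Icc.2 hs.1) (right_mem_Icc.2 hs.1) hs.1)).not_ge hws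

theorem exists_hasDerivWithinAt_of_lipschitzWith_of_bounded {E : Type*} [NormedAddCommGroup E]
    [NormedSpace ℝ E] [CompleteSpace E] {f : ℝ → E → E} {K L : ℝ≥0}
    (hlip : ∀ t ∈ Icc a b, LipschitzWith K (f t))
    (hcont : ∀ x, ContinuousOn (fun t => f t x) (Icc a b))
    (hbound : ∀ t ∈ Icc a b, ∀ x, ‖f t x‖ ≤ L) (t₀ : Icc a b) (x₀ : E) :
    ∃ u : ℝ → E, u t₀ = x₀ ∧ ∀ t ∈ Icc a b, HasDerivWithinAt u (f t (u t)) (Icc a b) t := by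
  have hlen : 0 ≤ max (b - t₀ : ℝ) (t₀ - a) := le_max_of_le_left (sub_nonneg.2 t₀.2.2)
  have hPL : IsPicardLindelof f t₀ x₀ (L * ⟨_, hlen⟩) 0 L K :=
    ⟨fun t ht => (hlip t ht).lipschitzOnWith, fun x _ => hcont x, fun t ht x _ => hbound t ht x,
      (sub_zero _).ge⟩
  exact hPL.exists_eq_forall_mem_Icc_hasDerivWithinAt₀

theorem abs_sq_projIcc_sub_sq_projIcc_le {C : ℝ} (hC : 0 ≤ C) (y z : ℝ) :
    |(projIcc 0 C hC y : ℝ) ^ 2 - projIcc 0 C hC z ^ 2| ≤ 2 * C * |y - z| := by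
  have hdiff : |(projIcc 0 C hC y : ℝ) - projIcc 0 C hC z| ≤ |y - z| := abs_projIcc_sub_projIcc hC
  obtain ⟨hy0, hyC⟩ := (projIcc 0 C hC y).2
  obtain ⟨hz0, hzC⟩ := (projIcc 0 C hC z).2
  have hsum : |(projIcc 0 C hC y : ℝ) + projIcc 0 C hC z| ≤ 2 * C := by
    rw [abs_of_nonneg (add_nonneg hy0 hz0)]
    linarith
  rw [sq_sub_sq, abs_mul]
  gcongr

theorem exists_truncated_riccati_solution (hab : a ≤ b) (hm : ContinuousOn m (Icc a b))
    (hh : ContinuousOn h (Icc a b)) {C : ℝ} (hC : 0 ≤ C) (c : ℝ) :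
    ∃ q : ℝ → ℝ, q b = c ∧ ∀ t ∈ Icc a b,
      HasDerivWithinAt q (m t * (projIcc 0 C hC (q t) : ℝ) ^ 2 - h t) (Icc a b) t := by
  obtain ⟨M, hM⟩ := isCompact_Icc.exists_bound_of_continuousOn hm
  obtain ⟨H, hH⟩ := isCompact_Icc.exists_bound_of_continuousOn hh
  have hM0 : 0 ≤ M := (norm_nonneg _).trans (hM b (right_mem_Icc.2 hab))
  have hH0 : 0 ≤ H := (norm_nonneg _).trans (hH b (right_mem_Icc.2 hab))
  refine exists_hasDerivWithinAt_of_lipschitzWith_of_bounded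
    (f := fun t y => m t * (projIcc 0 C hC y : ℝ) ^ 2 - h t) (K := ⟨M * (2 * C), by positivity⟩)
    (L := ⟨M * C ^ 2 + H, by positivity⟩) (fun t ht => ?_)
    (fun y => (hm.mul continuousOn_const).sub hh) (fun t ht y => ?_) ⟨b, right_mem_Icc.2 hab⟩ c
  · refine LipschitzWith.of_dist_le_mul fun y z => ?_
    calc dist (m t * (projIcc 0 C hC y : ℝ) ^ 2 - h t) (m t * (projIcc 0 C hC z : ℝ) ^ 2 - h t)
      _ = ‖m t‖ * |(projIcc 0 C hC y : ℝ) ^ 2 - projIcc 0 C hC z ^ 2| := by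
        rw [dist_sub_right, Real.dist_eq, ← mul_sub, abs_mul, Real.norm_eq_abs]
      _ ≤ M * (2 * C * |y - z|) :=
        mul_le_mul (hM t ht) (abs_sq_projIcc_sub_sq_projIcc_le hC y z) (abs_nonneg _) hM0
      _ = M * (2 * C) * dist y z := by rw [Real.dist_eq, mul_assoc M]
  · have hsq : ‖(projIcc 0 C hC y : ℝ) ^ 2‖ ≤ C ^ 2 := by
      rw [Real.norm_of_nonneg (sq_nonneg _)]
      exact pow_le_pow_left₀ (projIcc 0 C hC y).2.1 (projIcc 0 C hC y).2.2 2
    calc ‖m t * (projIcc 0 C hC y : ℝ) ^ 2 - h t‖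
      _ ≤ ‖m t‖ * ‖(projIcc 0 C hC y : ℝ) ^ 2‖ + ‖h t‖ := by
        rw [← norm_mul]
        exact norm_sub_le _ _
      _ ≤ M * C ^ 2 + H := by gcongr; exacts [hM t ht, hH t ht]

-- Truncating the quadratic term to `[0, C]` makes the equation globally Lipschitz; the barriers `0`
-- and `c + H (b - t)` show that for `C = c + H (b - a)` the truncation is never active.
theorem exists_nonneg_riccati_solution (hab : a ≤ b) (hm : ContinuousOn m (Icc a b))
    (hm0 : ∀ t ∈ Icc a b, 0 ≤ m t) (hh : ContinuousOn h (Icc a b))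
    (hh0 : ∀ t ∈ Icc a b, 0 ≤ h t) {c : ℝ} (hc : 0 ≤ c) :
    ∃ q : ℝ → ℝ, q b = c ∧ (∀ t ∈ Icc a b, 0 ≤ q t) ∧
      ∀ t ∈ Icc a b, HasDerivWithinAt q (m t * q t ^ 2 - h t) (Icc a b) t := by
  obtain ⟨H, hH⟩ := isCompact_Icc.bddAbove_image hh
  have hhH : ∀ t ∈ Icc a b, h t ≤ H := fun t ht => hH (mem_image_of_mem h ht)
  have hH0 : 0 ≤ H :=
    (hh0 b (right_mem_Icc.2 hab)).trans (hhH b (right_mem_Icc.2 hab))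
  have hC : 0 ≤ c + H * (b - a) := add_nonneg hc (mul_nonneg hH0 (sub_nonneg.2 hab))
  obtain ⟨q, hqb, hq⟩ := exists_truncated_riccati_solution hab hm hh hC c
  have hq0 : ∀ t ∈ Icc a b, 0 ≤ q t := by
    suffices ∀ t ∈ Icc a b, -q t ≤ 0 from fun t ht => neg_nonpos.1 (this t ht)
    refine nonpos_of_right_endpoint_nonpos (fun t ht => (hq t ht).neg) (by linarith)
      fun t ht hpos => ?_
    rw [projIcc_of_le_left hC (neg_pos.1 hpos).le]
    simpa using hh0 t ht
  have hqH : ∀ t ∈ Icc a b, q t - (c + H * (b - t)) ≤ 0 := by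
    refine nonpos_of_right_endpoint_nonpos (fun t ht => (hq t ht).sub
      ((((hasDerivWithinAt_id t _).const_sub b).const_mul H).const_add c)) (by simp [hqb])
      fun t ht _ => ?_
    have hquad : 0 ≤ m t * (projIcc 0 _ hC (q t) : ℝ) ^ 2 := mul_nonneg (hm0 t ht) (sq_nonneg _)
    linarith [hhH t ht]
  have hqC : ∀ t ∈ Icc a b, q t ≤ c + H * (b - a) := fun t ht => by
    have hdist : H * (b - t) ≤ H * (b - a) := by gcongr; exact ht.1
    linarith [hqH t ht]
  refine ⟨q, hqb, hq0, fun t ht => ?_⟩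
  simpa only [projIcc_of_mem hC ⟨hq0 t ht, hqC t ht⟩] using hq t ht

theorem le_riccati_solution (hm0 : ∀ t ∈ Icc a b, 0 ≤ m t) (hq0 : ∀ t ∈ Icc a b, 0 ≤ q t)
    (hq : ∀ t ∈ Icc a b, HasDerivWithinAt q (m t * q t ^ 2 - h t) (Icc a b) t) {p' : ℝ → ℝ}
    (hp : ∀ t ∈ Icc a b, HasDerivWithinAt p (p' t) (Icc a b) t)
    (hsub : ∀ t ∈ Icc a b, m t * p t ^ 2 - h t ≤ p' t) (hb : p b ≤ q b) :
    ∀ t ∈ Icc a b, p t ≤ q t := by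
  suffices ∀ t ∈ Icc a b, p t - q t ≤ 0 from fun t ht => sub_nonpos.1 (this t ht)
  refine nonpos_of_right_endpoint_nonpos (fun t ht => (hp t ht).sub (hq t ht))
    (sub_nonpos.2 hb) fun t ht hpos => ?_
  have hquad : m t * q t ^ 2 ≤ m t * p t ^ 2 :=
    mul_le_mul_of_nonneg_left (pow_le_pow_left₀ (hq0 t ht) (sub_pos.1 hpos).le 2) (hm0 t ht)
  linarith [hsub t ht]

theorem eq_zero_of_hasDerivWithinAt_eq_mul {r : ℝ → ℝ} (hr : ∀ t ∈ Icc a b, 0 ≤ r t)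
    (hw : ∀ t ∈ Icc a b, HasDerivWithinAt w (r t * w t) (Icc a b) t) (hb : w b = 0) :
    ∀ t ∈ Icc a b, w t = 0 := by
  have hle := nonpos_of_right_endpoint_nonpos hw hb.le fun t ht hpos =>
    mul_nonneg (hr t ht) hpos.le
  have hge := nonpos_of_right_endpoint_nonpos (w := fun t => -w t) (w' := fun t => r t * -w t)
    (fun t ht => (hw t ht).neg.congr_deriv (mul_neg _ _).symm) (by simp [hb])
    fun t ht hpos => mul_nonneg (hr t ht) hpos.le
  exact fun t ht => le_antisymm (hle t ht) (neg_nonpos.1 (hge t ht))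

end Riccati

/-- The function `a` is a radius of class `C¹` on `[0, ℓ]`: it is positive there, and `a'` is its
continuous derivative. -/
structure IsC1Radius (ℓ : ℝ) (a a' : ℝ → ℝ) : Prop where
  pos : ∀ t ∈ Icc 0 ℓ, 0 < a t
  hasDerivWithinAt : ∀ t ∈ Icc 0 ℓ, HasDerivWithinAt a (a' t) (Icc 0 ℓ) t
  continuousOn_deriv : ContinuousOn a' (Icc 0 ℓ)

/-- The function `q` is the conductance of the part of the fin beyond a given point, for the radius
`a` with derivative `a'`: it stands for the ratio `-a² T' / (T - T∞)`, which turns the fin equation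
into a Riccati equation with prescribed value at the tip. -/
structure IsConductance (ℓ β βr : ℝ) (a a' q : ℝ → ℝ) : Prop where
  nonneg : ∀ t ∈ Icc 0 ℓ, 0 ≤ q t
  tip : q ℓ = βr * a ℓ ^ 2
  hasDerivWithinAt : ∀ t ∈ Icc 0 ℓ,
    HasDerivWithinAt q ((a t ^ 2)⁻¹ * q t ^ 2 - β * (a t * √(1 + a' t ^ 2))) (Icc 0 ℓ) t

section Fin

variable {ℓ k β βr Td Tinf : ℝ} {a a' q T : ℝ → ℝ}

theorem IsC1Radius.continuousOn (ha : IsC1Radius ℓ a a') : ContinuousOn a (Icc 0 ℓ) :=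
  HasDerivWithinAt.continuousOn ha.hasDerivWithinAt

theorem IsC1Radius.continuousOn_inv_sq (ha : IsC1Radius ℓ a a') :
    ContinuousOn (fun t => (a t ^ 2)⁻¹) (Icc 0 ℓ) :=
  (ha.continuousOn.pow 2).inv₀ fun t ht => (pow_pos (ha.pos t ht) 2).ne'

theorem IsC1Radius.continuousOn_mul_sqrt (ha : IsC1Radius ℓ a a') :
    ContinuousOn (fun t => β * (a t * √(1 + a' t ^ 2))) (Icc 0 ℓ) :=
  continuousOn_const.mul
    (ha.continuousOn.mul (continuousOn_const.add (ha.continuousOn_deriv.pow 2)).sqrt)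

theorem IsC1Radius.exists_isConductance (ha : IsC1Radius ℓ a a') (hℓ : 0 ≤ ℓ) (hβ : 0 ≤ β)
    (hβr : 0 ≤ βr) : ∃ q, IsConductance ℓ β βr a a' q := by
  obtain ⟨q, hqℓ, hq0, hq⟩ := exists_nonneg_riccati_solution (c := βr * a ℓ ^ 2)
    hℓ ha.continuousOn_inv_sq (fun t _ => by positivity) (ha.continuousOn_mul_sqrt (β := β))
    (fun t ht => mul_nonneg hβ (mul_nonneg (ha.pos t ht).le (Real.sqrt_nonneg _))) (by positivity)
  exact ⟨q, hq0, hqℓ, hq⟩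

theorem IsC1Radius.hasWeakDeriv_flux_iff (ha : IsC1Radius ℓ a a') (hℓ : 0 ≤ ℓ) :
    HasWeakDeriv ℓ (fun x => a x ^ 2 * weakDeriv ℓ T x)
        (fun x => β * (a x * √(1 + weakDeriv ℓ a x ^ 2)) * (T x - Tinf)) ↔
      HasWeakDeriv ℓ (fun x => a x ^ 2 * weakDeriv ℓ T x)
        (fun x => β * (a x * √(1 + a' x ^ 2)) * (T x - Tinf)) := by
  have hsource : (fun x => β * (a x * √(1 + weakDeriv ℓ a x ^ 2)) * (T x - Tinf))
      =ᵐ[volume.restrict (Ioo 0 ℓ)] fun x => β * (a x * √(1 + a' x ^ 2)) * (T x - Tinf) := by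
    filter_upwards [(hasWeakDeriv_of_hasDerivWithinAt hℓ ha.hasDerivWithinAt
      ha.continuousOn_deriv).weakDeriv_ae_eq] with x hx
    rw [hx]
  exact ⟨fun h => h.congr_ae .rfl hsource, fun h => h.congr_ae .rfl hsource.symm⟩

theorem IsConductance.exists_isTemperature (hq : IsConductance ℓ β βr a a' q)
    (ha : IsC1Radius ℓ a a') (hℓ : 0 ≤ ℓ) : ∃ T, IsTemperature ℓ β βr Td Tinf a T := by
  have hqc : ContinuousOn q (Icc 0 ℓ) := HasDerivWithinAt.continuousOn hq.hasDerivWithinAt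
  have hrate : ContinuousOn (fun t => (a t ^ 2)⁻¹ * q t) (Icc 0 ℓ) :=
    ha.continuousOn_inv_sq.mul hqc
  let θ : ℝ → ℝ := fun x => (Td - Tinf) * Real.exp (-∫ t in (0 : ℝ)..x, (a t ^ 2)⁻¹ * q t)
  have hθ : ∀ x ∈ Icc 0 ℓ, HasDerivWithinAt θ (-((a x ^ 2)⁻¹ * q x * θ x)) (Icc 0 ℓ) x :=
    fun x hx => ((hasDerivWithinAt_integral_Icc hrate hx).neg.exp.const_mul _).congr_deriv
      (by dsimp only [θ, Pi.neg_apply]; ring)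
  have hθc : ContinuousOn θ (Icc 0 ℓ) := HasDerivWithinAt.continuousOn hθ
  have hT : ∀ x ∈ Icc 0 ℓ,
      HasDerivWithinAt (fun x => Tinf + θ x) (-((a x ^ 2)⁻¹ * q x * θ x)) (Icc 0 ℓ) x :=
    fun x hx => (hθ x hx).const_add Tinf
  have hT' : ContinuousOn (fun x => -((a x ^ 2)⁻¹ * q x * θ x)) (Icc 0 ℓ) := (hrate.mul hθc).neg
  have hflux : ∀ x ∈ Icc 0 ℓ, HasDerivWithinAt (fun x => -(q x * θ x))
      (β * (a x * √(1 + a' x ^ 2)) * (Tinf + θ x - Tinf)) (Icc 0 ℓ) x := fun x hx =>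
    ((hq.hasDerivWithinAt x hx).mul (hθ x hx)).neg.congr_deriv (by ring)
  refine ⟨fun x => Tinf + θ x, memSobolev_of_hasDerivWithinAt hℓ 2 hT hT',
    (ha.hasWeakDeriv_flux_iff hℓ).2 ?_, ?_, ?_⟩
  · refine (hasWeakDeriv_of_hasDerivWithinAt hℓ hflux (ha.continuousOn_mul_sqrt.mul
      ((continuousOn_const.add hθc).sub continuousOn_const))).congr_ae ?_ .rfl
    filter_upwards [(hasWeakDeriv_of_hasDerivWithinAt hℓ hT hT').weakDeriv_ae_eq,
      ae_restrict_mem measurableSet_Ioo] with x hx hxI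
    have hax : a x ≠ 0 := (ha.pos x (Ioo_subset_Icc_self hxI)).ne'
    rw [hx]
    field_simp
  · simp [θ]
  · have haℓ : a ℓ ≠ 0 := (ha.pos ℓ (right_mem_Icc.2 hℓ)).ne'
    refine (hT ℓ (right_mem_Icc.2 hℓ)).congr_deriv ?_
    rw [hq.tip, add_sub_cancel_left]
    field_simp

theorem IsTemperature.exists_flux (hT : IsTemperature ℓ β βr Td Tinf a T)
    (ha : IsC1Radius ℓ a a') (hℓ : 0 < ℓ) :
    ∃ P : ℝ → ℝ,
      (∀ x ∈ Icc 0 ℓ,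
        HasDerivWithinAt P (β * (a x * √(1 + a' x ^ 2)) * (T x - Tinf)) (Icc 0 ℓ) x) ∧
      ∀ x ∈ Icc 0 ℓ, HasDerivWithinAt T ((a x ^ 2)⁻¹ * P x) (Icc 0 ℓ) x := by
  obtain ⟨P, hTP, hP⟩ := ((ha.hasWeakDeriv_flux_iff hℓ.le).1 hT.equation).exists_ae_eq_primitive
    hℓ (ha.continuousOn_mul_sqrt.mul (hT.memSobolev.continuousOn.sub continuousOn_const))
  refine ⟨P, hP, HasWeakDeriv.hasDerivWithinAt ?_ hℓ hT.memSobolev.continuousOn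
    (ha.continuousOn_inv_sq.mul (HasDerivWithinAt.continuousOn hP))⟩
  obtain ⟨g, -, hg⟩ := hT.memSobolev.exists_weakDeriv
  refine (hasWeakDeriv_weakDeriv hg).congr_ae .rfl ?_
  filter_upwards [hTP, ae_restrict_mem measurableSet_Ioo] with x hx hxI
  have hax : a x ^ 2 ≠ 0 := (pow_pos (ha.pos x (Ioo_subset_Icc_self hxI)) 2).ne'
  exact (eq_inv_mul_iff_mul_eq₀ hax).2 hx

-- With `P = a² T'`, the function `P + q (T - T∞)` solves a homogeneous linear equation and vanishes
-- at the tip.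
theorem IsConductance.derivWithin_inlet (hq : IsConductance ℓ β βr a a' q)
    (ha : IsC1Radius ℓ a a') (hℓ : 0 < ℓ) (hT : IsTemperature ℓ β βr Td Tinf a T) :
    derivWithin T (Icc 0 ℓ) 0 = -((a 0 ^ 2)⁻¹ * (q 0 * (Td - Tinf))) := by
  have h0 : (0 : ℝ) ∈ Icc 0 ℓ := left_mem_Icc.2 hℓ.le
  have hℓI : ℓ ∈ Icc 0 ℓ := right_mem_Icc.2 hℓ.le
  obtain ⟨P, hP, hTP⟩ := hT.exists_flux ha hℓ
  have hPℓ : (a ℓ ^ 2)⁻¹ * P ℓ = -βr * (T ℓ - Tinf) :=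
    (uniqueDiffOn_Icc hℓ ℓ hℓI).eq_deriv _ (hTP ℓ hℓI) hT.tip
  have hzero : ∀ x ∈ Icc 0 ℓ, P x + q x * (T x - Tinf) = 0 := by
    refine eq_zero_of_hasDerivWithinAt_eq_mul (r := fun x => (a x ^ 2)⁻¹ * q x)
      (fun x hx => mul_nonneg (by positivity) (hq.nonneg x hx)) (fun x hx => ?_) ?_
    · exact ((hP x hx).add ((hq.hasDerivWithinAt x hx).mul
        ((hTP x hx).sub_const Tinf))).congr_deriv (by ring)
    · have haℓ : a ℓ ≠ 0 := (ha.pos ℓ hℓI).ne'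
      rw [inv_mul_eq_iff_eq_mul₀ (pow_ne_zero 2 haℓ)] at hPℓ
      rw [hPℓ, hq.tip]
      ring
  rw [(hTP 0 h0).derivWithin (uniqueDiffOn_Icc hℓ 0 h0), eq_neg_of_add_eq_zero_left (hzero 0 h0),
    hT.inlet, mul_neg]

theorem IsConductance.heatFlux_eq (hq : IsConductance ℓ β βr a a' q) (ha : IsC1Radius ℓ a a')
    (hℓ : 0 < ℓ) : heatFlux ℓ k β βr Td Tinf a = k * Real.pi * (Td - Tinf) * q 0 := by
  have hT : ∃ T, IsTemperature ℓ β βr Td Tinf a T := hq.exists_isTemperature ha hℓ.le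
  have ha0 : a 0 ≠ 0 := (ha.pos 0 (left_mem_Icc.2 hℓ.le)).ne'
  rw [heatFlux, dif_pos hT, hq.derivWithin_inlet ha hℓ hT.choose_spec]
  field_simp

theorem riccati_subsolution_bound {b r s : ℝ} (hβ : 0 ≤ β) (hb : 0 < b) (hbr : b ≤ r)
    (hs : β * (r - b) ≤ 2 * s) :
    (r ^ 2)⁻¹ * (β / 4 * (r ^ 2 - b ^ 2)) ^ 2 - β * (r * √(1 + s ^ 2)) ≤ -(β / 2 * r * s) := by
  have hr : 0 < r := hb.trans_le hbr
  have hsub : 0 ≤ r - b := sub_nonneg.2 hbr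
  have hsqrt : s ≤ √(1 + s ^ 2) := Real.le_sqrt_of_sq_le (by linarith)
  have hp : β / 4 * (r ^ 2 - b ^ 2) ≤ β / 2 * (r - b) * r := by
    nlinarith [mul_nonneg hβ (sq_nonneg (r - b))]
  have hp0 : 0 ≤ β / 4 * (r ^ 2 - b ^ 2) :=
    mul_nonneg (by positivity) (sub_nonneg.2 (pow_le_pow_left₀ hb.le hbr 2))
  have hquad : (r ^ 2)⁻¹ * (β / 4 * (r ^ 2 - b ^ 2)) ^ 2 ≤ β / 2 * r * s := calc
    _ ≤ (r ^ 2)⁻¹ * (β / 2 * (r - b) * r) ^ 2 := by gcongr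
    _ = β / 2 * (r - b) * (β * (r - b) / 2) := by field_simp
    _ ≤ β / 2 * r * s := mul_le_mul (mul_le_mul_of_nonneg_left (by linarith) (by positivity))
      (by linarith) (div_nonneg (mul_nonneg hβ hsub) zero_le_two) (by positivity)
  have hsource : β * (r * s) ≤ β * (r * √(1 + s ^ 2)) := by gcongr
  linarith

theorem IsC1Radius.le_heatFlux (ha : IsC1Radius ℓ a a') (hℓ : 0 < ℓ) (hk : 0 ≤ k) (hβ : 0 ≤ β)
    (hβr : 0 ≤ βr) (hTd : Tinf ≤ Td) (hmin : ∀ t ∈ Icc 0 ℓ, a ℓ ≤ a t)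
    (hsteep : ∀ t ∈ Icc 0 ℓ, β * (a t - a ℓ) ≤ 2 * -a' t) :
    k * Real.pi * (Td - Tinf) * (β / 4 * (a 0 ^ 2 - a ℓ ^ 2)) ≤
      heatFlux ℓ k β βr Td Tinf a := by
  obtain ⟨q, hq⟩ := ha.exists_isConductance hℓ.le hβ hβr
  have haℓ : 0 < a ℓ := ha.pos ℓ (right_mem_Icc.2 hℓ.le)
  have hle : ∀ t ∈ Icc 0 ℓ, β / 4 * (a t ^ 2 - a ℓ ^ 2) ≤ q t := by
    refine le_riccati_solution (fun t _ => by positivity) hq.nonneg hq.hasDerivWithinAt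
      (fun t ht => (((ha.hasDerivWithinAt t ht).pow 2).sub_const _).const_mul _)
      (fun t ht => ?_) ?_
    · refine (le_of_eq ?_).trans
        ((riccati_subsolution_bound hβ haℓ (hmin t ht) (hsteep t ht)).trans_eq ?_)
      · rw [neg_sq]
      · push_cast
        ring
    · rw [sub_self, mul_zero, hq.tip]
      positivity
  rw [hq.heatFlux_eq ha hℓ]
  exact mul_le_mul_of_nonneg_left (hle 0 (left_mem_Icc.2 hℓ.le))
    (mul_nonneg (mul_nonneg hk Real.pi_pos.le) (sub_nonneg.2 hTd))

end Fin

/-- The radius `a₀ + B (1 - x / ℓ)ⁿ`, which decreases from `a₀ + B` at the inlet to `a₀` at the tip.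
For large `n` it is a thin fin with a steep flare at the inlet, whose inlet area stays fixed while
the additional volume tends to `0`. -/
noncomputable def flare (a₀ B ℓ : ℝ) (n : ℕ) (x : ℝ) : ℝ := a₀ + B * (1 - x / ℓ) ^ n

section Flare

variable {ℓ k β βr Td Tinf a₀ a₁ B V₀ x : ℝ} {n : ℕ}

theorem flare_zero : flare a₀ B ℓ n 0 = a₀ + B := by simp [flare]

theorem flare_self (hℓ : ℓ ≠ 0) (hn : n ≠ 0) : flare a₀ B ℓ n ℓ = a₀ := by simp [flare, hℓ, hn]

theorem le_flare (hB : 0 ≤ B) (hℓ : 0 ≤ ℓ) (hx : x ≤ ℓ) : a₀ ≤ flare a₀ B ℓ n x :=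
  le_add_of_nonneg_right
    (mul_nonneg hB (pow_nonneg (sub_nonneg.2 (div_le_one_of_le₀ hx hℓ)) n))

theorem hasDerivAt_flare :
    HasDerivAt (flare a₀ B ℓ n) (-(B * (n / ℓ) * (1 - x / ℓ) ^ (n - 1))) x :=
  ((((((hasDerivAt_id x).div_const ℓ).const_sub 1).pow n).const_mul B).const_add a₀).congr_deriv
    (by dsimp only [id]; ring)

theorem continuous_deriv_flare :
    Continuous fun x : ℝ => -(B * (n / ℓ) * (1 - x / ℓ) ^ (n - 1)) := by
  fun_prop

theorem isC1Radius_flare (ha₀ : 0 < a₀) (hB : 0 ≤ B) (hℓ : 0 ≤ ℓ) :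
    IsC1Radius ℓ (flare a₀ B ℓ n) fun x => -(B * (n / ℓ) * (1 - x / ℓ) ^ (n - 1)) where
  pos _ ht := ha₀.trans_le (le_flare hB hℓ ht.2)
  hasDerivWithinAt _ _ := hasDerivAt_flare.hasDerivWithinAt
  continuousOn_deriv := continuous_deriv_flare.continuousOn

theorem finVol_flare (hℓ : 0 < ℓ) :
    finVol ℓ (flare a₀ B ℓ n) =
      ℓ * (a₀ ^ 2 + 2 * a₀ * B / (n + 1) + B ^ 2 / (2 * n + 1)) := by
  have hpow (m : ℕ) : ∫ y in (0 : ℝ)..1, y ^ m = 1 / (m + 1) := by simp [integral_pow]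
  have hint (c : ℝ) (m : ℕ) : IntervalIntegrable (fun y : ℝ => c * y ^ m) volume 0 1 :=
    Continuous.intervalIntegrable (by fun_prop) 0 1
  calc finVol ℓ (flare a₀ B ℓ n)
    _ = ∫ x in (0 : ℝ)..ℓ, (a₀ + B * (1 - x / ℓ) ^ n) ^ 2 := by
      rw [finVol, ← integral_Ioc_eq_integral_Ioo, intervalIntegral.integral_of_le hℓ.le]
      rfl
    _ = ℓ * ∫ y in (0 : ℝ)..1, (a₀ + B * y ^ n) ^ 2 := by
      rw [intervalIntegral.integral_comp_sub_div (fun y => (a₀ + B * y ^ n) ^ 2) hℓ.ne',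
        div_self hℓ.ne', zero_div, sub_self, sub_zero, smul_eq_mul]
    _ = ℓ * ∫ y in (0 : ℝ)..1, (a₀ ^ 2 + 2 * a₀ * B * y ^ n + B ^ 2 * y ^ (2 * n)) := by
      congr! 3 with y
      ring
    _ = ℓ * (a₀ ^ 2 + 2 * a₀ * B / (n + 1) + B ^ 2 / (2 * n + 1)) := by
      rw [intervalIntegral.integral_add (intervalIntegrable_const.add (hint _ _)) (hint _ _),
        intervalIntegral.integral_add intervalIntegrable_const (hint _ _)]
      simp [hpow, div_eq_mul_inv]

theorem tendsto_finVol_flare (hℓ : 0 < ℓ) :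
    Tendsto (fun n : ℕ => finVol ℓ (flare a₀ B ℓ n)) atTop (𝓝 (ℓ * a₀ ^ 2)) := by
  have hlin : Tendsto (fun n : ℕ => (n : ℝ) + 1) atTop atTop :=
    tendsto_atTop_add_const_right _ 1 tendsto_natCast_atTop_atTop
  have hlin₂ : Tendsto (fun n : ℕ => 2 * (n : ℝ) + 1) atTop atTop :=
    tendsto_atTop_add_const_right _ 1 (tendsto_natCast_atTop_atTop.const_mul_atTop two_pos)
  simpa only [finVol_flare hℓ, add_zero] using (((hlin.const_div_atTop (2 * a₀ * B)).const_add
    (a₀ ^ 2)).add (hlin₂.const_div_atTop (B ^ 2))).const_mul ℓ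

theorem flare_mem_volClass (hB : 0 ≤ B) (hℓ : 0 ≤ ℓ) (hV : finVol ℓ (flare a₀ B ℓ n) ≤ V₀) :
    flare a₀ B ℓ n ∈ volClass a₀ ℓ V₀ := by
  refine ⟨memSobolev_of_hasDerivWithinAt hℓ ∞ (fun x _ => hasDerivAt_flare.hasDerivWithinAt)
    continuous_deriv_flare.continuousOn, ?_, hV⟩
  filter_upwards [ae_restrict_mem measurableSet_Ioo] with x hx using le_flare hB hℓ hx.2.le

theorem le_heatFlux_flare (ha₀ : 0 < a₀) (hB : 0 ≤ B) (hℓ : 0 < ℓ) (hk : 0 ≤ k) (hβ : 0 ≤ β)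
    (hβr : 0 ≤ βr) (hTd : Tinf ≤ Td) (hn : n ≠ 0) (hβn : β * ℓ ≤ 2 * n) :
    k * Real.pi * (Td - Tinf) * (β / 4 * ((a₀ + B) ^ 2 - a₀ ^ 2)) ≤
      heatFlux ℓ k β βr Td Tinf (flare a₀ B ℓ n) := by
  have htip : flare a₀ B ℓ n ℓ = a₀ := flare_self hℓ.ne' hn
  have hbound := (isC1Radius_flare (n := n) ha₀ hB hℓ.le).le_heatFlux hℓ hk hβ hβr hTd
    (fun t ht => htip.le.trans (le_flare hB hℓ.le ht.2)) fun t ht => ?_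
  · rwa [htip, flare_zero] at hbound
  have hy0 : 0 ≤ 1 - t / ℓ := sub_nonneg.2 (div_le_one_of_le₀ ht.2 hℓ.le)
  have hy1 : 1 - t / ℓ ≤ 1 := sub_le_self 1 (div_nonneg ht.1 hℓ.le)
  calc β * (flare a₀ B ℓ n t - flare a₀ B ℓ n ℓ)
    _ = β * (B * (1 - t / ℓ) ^ n) := by rw [htip, flare, add_sub_cancel_left]
    _ ≤ 2 * n / ℓ * (B * (1 - t / ℓ) ^ (n - 1)) := by
      refine mul_le_mul ((le_div_iff₀ hℓ).2 hβn) (mul_le_mul_of_nonneg_left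
        (pow_le_pow_of_le_one hy0 hy1 (n.sub_le 1)) hB) ?_ ?_ <;> positivity
    _ = 2 * - -(B * (n / ℓ) * (1 - t / ℓ) ^ (n - 1)) := by ring

theorem exists_lt_heatFlux (ha₀ : 0 < a₀) (hℓ : 0 < ℓ) (hV₀ : ℓ * a₀ ^ 2 < V₀) (hk : 0 < k)
    (hβ : 0 < β) (hβr : 0 ≤ βr) (hTd : Tinf < Td) (M : ℝ) :
    ∃ a ∈ volClass a₀ ℓ V₀, M < heatFlux ℓ k β βr Td Tinf a := by
  have hK : 0 < k * Real.pi * (Td - Tinf) * (β / 4) :=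
    mul_pos (mul_pos (mul_pos hk Real.pi_pos) (sub_pos.2 hTd)) (by positivity)
  obtain ⟨B, hBM, hB⟩ : ∃ B,
      M < k * Real.pi * (Td - Tinf) * (β / 4 * ((a₀ + B) ^ 2 - a₀ ^ 2)) ∧ 0 ≤ B := by
    have hsq : Tendsto (fun B => (a₀ + B) ^ 2 - a₀ ^ 2) atTop atTop :=
      tendsto_atTop_add_const_right _ _
        ((tendsto_pow_atTop two_ne_zero).comp (tendsto_atTop_add_const_left _ a₀ tendsto_id))
    simp only [← mul_assoc _ (β / 4)]
    exact (((hsq.const_mul_atTop hK).eventually_gt_atTop M).and (eventually_ge_atTop 0)).exists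
  obtain ⟨n, hnV, hn, hβn⟩ : ∃ n : ℕ,
      finVol ℓ (flare a₀ B ℓ n) < V₀ ∧ n ≠ 0 ∧ β * ℓ ≤ 2 * n := by
    have hlin : Tendsto (fun n : ℕ => 2 * (n : ℝ)) atTop atTop :=
      tendsto_natCast_atTop_atTop.const_mul_atTop two_pos
    exact (((tendsto_finVol_flare hℓ).eventually_lt_const hV₀).and
      ((eventually_ne_atTop 0).and (hlin.eventually_ge_atTop (β * ℓ)))).exists
  exact ⟨flare a₀ B ℓ n, flare_mem_volClass hB hℓ.le hnV.le,
    hBM.trans_le (le_heatFlux_flare ha₀ hB hℓ hk.le hβ.le hβr hTd.le hn hβn)⟩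

theorem volClass_anti_left (h : a₀ ≤ a₁) : volClass a₁ ℓ V₀ ⊆ volClass a₀ ℓ V₀ :=
  fun _ ha => ⟨ha.1, ha.2.1.mono fun _ hx => h.trans hx, ha.2.2⟩

end Flare

theorem theorem1_general (k β βr Td Tinf a₀ ℓ V₀ : ℝ) (hk : 0 < k) (hβ : 0 < β) (hβr : 0 ≤ βr)
    (hTd : Tinf < Td) (hℓ : 0 < ℓ) (hV₀ : ℓ * a₀ ^ 2 < V₀) :
    (¬ ∃ a ∈ volClass a₀ ℓ V₀, ∀ c ∈ volClass a₀ ℓ V₀,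
      heatFlux ℓ k β βr Td Tinf c ≤ heatFlux ℓ k β βr Td Tinf a) ∧
    (⨆ a ∈ volClass a₀ ℓ V₀, (heatFlux ℓ k β βr Td Tinf a : EReal)) = ⊤ := by
  obtain ⟨a₁, ha₁, hV₁⟩ : ∃ a₁, |a₀| < a₁ ∧ ℓ * a₁ ^ 2 < V₀ := by
    have hlt : |a₀| < √(V₀ / ℓ) := by
      rwa [Real.lt_sqrt (abs_nonneg a₀), sq_abs, lt_div_iff₀' hℓ]
    obtain ⟨a₁, ha₁, hV₁⟩ := exists_between hlt
    rw [Real.lt_sqrt ((abs_nonneg a₀).trans ha₁.le), lt_div_iff₀' hℓ] at hV₁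
    exact ⟨a₁, ha₁, hV₁⟩
  have hlarge (M : ℝ) : ∃ a ∈ volClass a₀ ℓ V₀, M < heatFlux ℓ k β βr Td Tinf a := by
    obtain ⟨a, ha, hM⟩ := exists_lt_heatFlux ((abs_nonneg a₀).trans_lt ha₁) hℓ hV₁ hk hβ hβr hTd M
    exact ⟨a, volClass_anti_left ((le_abs_self a₀).trans ha₁.le) ha, hM⟩
  refine ⟨fun ⟨a, _, hmax⟩ => ?_, EReal.eq_top_iff_forall_lt _ |>.2 fun M => ?_⟩
  · obtain ⟨c, hc, hlt⟩ := hlarge (heatFlux ℓ k β βr Td Tinf a)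
    exact (hmax c hc).not_gt hlt
  · obtain ⟨a, ha, hlt⟩ := hlarge M
    exact (EReal.coe_lt_coe_iff.2 hlt).trans_le (le_iSup₂_of_le a ha le_rfl)

theorem theorem1 (k β βr Td Tinf a₀ ℓ V₀ : ℝ)
    (hk : 0 < k) (hβ : 0 < β) (hβr : 0 ≤ βr) (hTinf : 0 < Tinf) (hTd : Tinf < Td)
    (ha₀ : 0 < a₀) (hℓ : 0 < ℓ) (hV₀ : ℓ * a₀ ^ 2 < V₀) :
    (¬ ∃ a ∈ volClass a₀ ℓ V₀, ∀ c ∈ volClass a₀ ℓ V₀,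
      heatFlux ℓ k β βr Td Tinf c ≤ heatFlux ℓ k β βr Td Tinf a) ∧
    (⨆ a ∈ volClass a₀ ℓ V₀, (heatFlux ℓ k β βr Td Tinf a : EReal)) = ⊤ :=
  theorem1_general k β βr Td Tinf a₀ ℓ V₀ hk hβ hβr hTd hℓ hV₀
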